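/- Let $X$ be a set of infinite regular cardinality, equipped with a well-order whose order type is the initial ordinal of $|X|$ (so $X$ may be identified with a regular cardinal). Let $\mathcal O=\bigcup_{n\ge 1}\mathcal O^{(n)}$, where $\mathcal O^{(n)}$ is the set of all functions $X^n\to X$. A \emph{clone} on $X$ is a subset of $\mathcal O$ that contains all projections $(x_1,\dots,x_n)\mapsto x_k$ ($1\le k\le n$) and is closed under composition; $\langle\mathcal F\rangle$ denotes the smallest clone containing $\mathcal F\subseteq\mathcal O$. A function $f\in\mathcal O^{(n)}$ is \emph{almost unary} if there are $1\le k\le n$ and $F:X\to\mathcal P(X)$ such that $|F(y)|<|X|$ for all $y\in X$ and $f(x_1,\dots,x_n)\in F(x_k)$ for all $(x_1,\dots,x_n)\in X^n$. Let $\mathcal U$ be the set of all almost unary functions and $T_1=\mathcal U\cap\mathcal O^{(2)}$. For $n\ge 2$ let $m^n_2\in\mathcal O^{(n)}$ be the function returning the second smallest entry (counted with multiplicity) of an $n$-tuple, that is, $m^n_2(x_1,\dots,x_n)=x_{j_2}$ if $x_{j_1}\le x_{j_2}\le\dots\le x_{j_n}$ with $\{j_1,\dots,j_n\}=\{1,\dots,n\}$,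 and let $\mathcal M_n=\langle\{m^n_2\}\cup T_1\rangle$. Then $\mathcal U$ is a clone, and for every clone $\mathcal C$ on $X$ with $\mathcal C\supsetneq\mathcal U$ there is an $n\ge 2$ such that $\mathcal C=\mathcal M_n$. Consequently, the interval $[\mathcal U,\mathcal O]$ of all clones on $X$ containing $\mathcal U$ is exactly $\{\mathcal M_n : n\ge 2\}\cup\{\mathcal U\}$. -/

import Mathlib

namespace CloneTheory

universe u

/-- The set of all finitary operations on `X`: pairs of an arity `n ≥ 1` and a function
from `n`-tuples of elements of `X` to `X`. -/
abbrev Op (X : Type u) : Type u := Σ n : ℕ+, ((Fin n → X) → X)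

/-- A clone on `X` is a set of finitary operations which contains all projections and is
closed under composition. -/
structure IsClone {X : Type u} (C : Set (Op X)) : Prop where
  proj_mem : ∀ (n : ℕ+) (k : Fin n), (⟨n, fun x => x k⟩ : Op X) ∈ C
  comp_mem : ∀ (n m : ℕ+) (f : (Fin n → X) → X) (g : Fin n → ((Fin m → X) → X)),
    (⟨n, f⟩ : Op X) ∈ C → (∀ i, (⟨m, g i⟩ : Op X) ∈ C) →
      (⟨m, fun x => f (fun i => g i x)⟩ : Op X) ∈ C

/-- The clone generated by a set `F` of operations: the intersection of all clones
containing `F`. -/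
def cloneGen {X : Type u} (F : Set (Op X)) : Set (Op X) :=
  ⋂₀ {C : Set (Op X) | IsClone C ∧ F ⊆ C}

theorem isClone_cloneGen {X : Type u} (F : Set (Op X)) : IsClone (cloneGen F) where
  proj_mem n k := fun _ hC => hC.1.proj_mem n k
  comp_mem n m f g hf hg := fun C hC =>
    hC.1.comp_mem n m f g (hf C hC) (fun i => hg i C hC)

theorem subset_cloneGen {X : Type u} (F : Set (Op X)) : F ⊆ cloneGen F :=
  fun _ hf _ hC => hC.2 hf

theorem cloneGen_subset {X : Type u} {F C : Set (Op X)} (hC : IsClone C) (h : F ⊆ C) :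
    cloneGen F ⊆ C :=
  fun _ hf => hf C ⟨hC, h⟩

/-- A subset of `X` is large if it has the same cardinality as `X`. -/
def IsLarge {X : Type u} (S : Set X) : Prop := Cardinal.mk S = Cardinal.mk X

/-- A subset of `X` is small if it is not large. -/
def IsSmall {X : Type u} (S : Set X) : Prop := ¬ IsLarge S

/-- An operation is almost unary if one of its variables determines its value up to a small
set. -/
def IsAlmostUnary {X : Type u} (f : Op X) : Prop :=
  ∃ (F : X → Set X) (k : Fin f.1), (∀ y, IsSmall (F y)) ∧ ∀ x : Fin f.1 → X, f.2 x ∈ F (x k)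

/-- The set `𝒰` of all almost unary operations on `X`. -/
def almostUnary (X : Type u) : Set (Op X) := {f | IsAlmostUnary f}

/-- The set `T₁` of all binary almost unary operations on `X`. -/
def T₁ (X : Type u) : Set (Op X) := {f | f.1 = 2 ∧ IsAlmostUnary f}

/-- The operation returning the `k`-th smallest entry of an `n`-tuple (with multiplicities),
where `k` is counted from `0`: `Tuple.sort x` is a permutation `σ` of the indices for which
`x (σ 0) ≤ x (σ 1) ≤ ⋯`. -/
def orderStat (X : Type u) [LinearOrder X] (n : ℕ+) (k : Fin n) : Op X :=
  ⟨n, fun x => x (Tuple.sort x k)⟩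

/-- The operation `m^n_2`, returning the second smallest entry of an `n`-tuple, `n ≥ 2`. -/
def secondSmallest (X : Type u) [LinearOrder X] (n : ℕ+) (hn : 2 ≤ n) : Op X :=
  orderStat X n ⟨1, hn⟩

/-- The clone `ℳ_n` generated by `m^n_2` together with `T₁`. -/
def M (X : Type u) [LinearOrder X] (n : ℕ+) (hn : 2 ≤ n) : Set (Op X) :=
  cloneGen ({secondSmallest X n hn} ∪ T₁ X)

/-- The interval `[C, D]` in the lattice of all clones on `X`, ordered by inclusion. -/
def cloneInterval {X : Type u} (C D : Set (Op X)) : Set (Set (Op X)) :=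
  {E | IsClone E ∧ C ⊆ E ∧ E ⊆ D}

end CloneTheory

/-!
By regularity, the small subsets of `X` are exactly the bounded ones (`isSmall_iff_bddAbove`), so
`f` is almost unary iff `f x ≤ γ (x k)` for some `γ : X → X` and some variable `k`. The almost
unary operations form a clone, generated by its binary members (`IsClone.almostUnary_subset`), and
every clone `C` above it is closed under domination: `g ∈ C` and `f x ≤ γ (g x)` imply `f ∈ C`
(`IsClone.mem_of_le`). Only the growth of operations matters.

The growth of `f` is governed by the sets `B` of variables which do not bound `f`, that is, such
that `f` is unbounded on some set of tuples whose entries in `B` are bounded (`UnboundedOver`).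
The set of all variables always bounds `f`, and if `f` is not almost unary, then no singleton
bounds `f`. Hence the variables of such an `f` are covered by finitely many sets not bounding `f`,
but not by one. Let `n ≥ 2` be the least size of such a cover, over all `f ∈ C`.

* If `f` has a cover of size `n`, then `f` generates `m^n_2` over the almost unary operations
  (`IsClone.secondSmallest_mem`). So `ℳ_n ⊆ C`.
* If the variables of `f` have no cover by fewer than `n` sets not bounding `f`, then any fewer
  than `n` complements of such sets have a common element. As in Post's description of the monotone
  Boolean clones, nesting `m^n_2` then gives an operation `g` that dominates the minimum over each
  of these complements (`IsClone.exists_dominating`), and `f` is bounded in terms of `g`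
  (`IsClone.mem_of_not_cover`). So `C ⊆ ℳ_n`.
-/

namespace CloneTheory

universe u

variable {X : Type u}

/-! ### Small sets are the bounded sets -/

theorem isSmall_iff_mk_lt {S : Set X} : IsSmall S ↔ Cardinal.mk S < Cardinal.mk X :=
  (lt_iff_le_and_ne.trans (and_iff_right (Cardinal.mk_set_le S))).symm

theorem isSmall_iff_bddAbove [LinearOrder X] [WellFoundedLT X]
    (hreg : (Cardinal.mk X).IsRegular)
    (htype : Ordinal.type ((· < ·) : X → X → Prop) = (Cardinal.mk X).ord) (S : Set X) :
    IsSmall S ↔ BddAbove S := by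
  have hcof : Order.cof X = Cardinal.mk X := by
    rw [← Ordinal.cof_type, htype, hreg.cof_ord]
  rw [isSmall_iff_mk_lt]
  constructor
  · intro h
    refine .of_not_isCofinal fun hS => ?_
    exact absurd (Order.cof_le hS) (by rw [hcof]; exact not_le.2 h)
  · rintro ⟨c, hc⟩
    refine (Cardinal.mk_le_mk_of_subset (fun a ha => hc ha : S ⊆ Set.Iic c)).trans_lt ?_
    exact Cardinal.mk_Iic_lt c htype.symm hreg.aleph0_le

section Bounded

variable [LinearOrder X]

theorem exists_bound_of_mk_lt (hb : ∀ S : Set X, IsSmall S ↔ BddAbove S) {α : Type u} (f : α → X)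
    (h : Cardinal.mk α < Cardinal.mk X) : ∃ c, ∀ a, f a ≤ c := by
  obtain ⟨c, hc⟩ := (hb (Set.range f)).1 (isSmall_iff_mk_lt.2 (Cardinal.mk_range_le.trans_lt h))
  exact ⟨c, fun a => hc ⟨a, rfl⟩⟩

theorem mk_Iic_lt_of_isSmall_iff (hb : ∀ S : Set X, IsSmall S ↔ BddAbove S) (c : X) :
    Cardinal.mk (Set.Iic c) < Cardinal.mk X :=
  isSmall_iff_mk_lt.1 ((hb _).2 bddAbove_Iic)

/-- Every unary operation is dominated by one that bounds it on whole initial segments. -/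
theorem exists_bound_on_Iic (hb : ∀ S : Set X, IsSmall S ↔ BddAbove S) (f : X → X) :
    ∃ γ : X → X, ∀ a b, a ≤ b → f a ≤ γ b := by
  have h (b : X) : ∃ c, ∀ a : Set.Iic b, f a ≤ c :=
    exists_bound_of_mk_lt hb _ (mk_Iic_lt_of_isSmall_iff hb b)
  choose γ hγ using h
  exact ⟨γ, fun a b hab => hγ b ⟨a, hab⟩⟩

/-- Finitely many unary operations have a common bound on initial segments. -/
theorem exists_common_bound_on_Iic [Nonempty X] (hb : ∀ S : Set X, IsSmall S ↔ BddAbove S)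
    {ι : Type*} [Finite ι] (f : ι → X → X) : ∃ γ : X → X, ∀ j a b, a ≤ b → f j a ≤ γ b := by
  choose g hg using fun j => exists_bound_on_Iic hb (f j)
  have h (b : X) : BddAbove (Set.range fun j => g j b) := (Set.finite_range _).bddAbove
  choose γ hγ using h
  exact ⟨γ, fun j a b hab => (hg j a b hab).trans (hγ b ⟨j, rfl⟩)⟩

theorem exists_gt_of_isSmall_iff (hb : ∀ S : Set X, IsSmall S ↔ BddAbove S) (a : X) :
    ∃ b, a < b := by
  by_contra! h
  exact (hb Set.univ).2 ⟨a, fun b _ => h b⟩ Cardinal.mk_univ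

/-- An operation is bounded on the tuples with bounded entries. -/
theorem exists_bound_on_tuples [Infinite X] (hb : ∀ S : Set X, IsSmall S ↔ BddAbove S) {n : ℕ}
    (f : (Fin n → X) → X) (c : X) : ∃ d, ∀ x, (∀ i, x i ≤ c) → f x ≤ d := by
  have hcard : Cardinal.mk (Fin n → Set.Iic c) < Cardinal.mk X := by
    have hc := mk_Iic_lt_of_isSmall_iff hb c
    rcases finite_or_infinite (Set.Iic c) with hfin | hinf
    · exact (Cardinal.lt_aleph0_of_finite _).trans_le (Cardinal.aleph0_le_mk X)
    · refine lt_of_le_of_lt ?_ hc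
      rw [Cardinal.mk_arrow, Cardinal.lift_id', Cardinal.mk_fin, Cardinal.lift_natCast]
      exact Cardinal.power_nat_le (Cardinal.aleph0_le_mk _)
  obtain ⟨d, hd⟩ := exists_bound_of_mk_lt hb (fun y : Fin n → Set.Iic c => f fun i => y i) hcard
  exact ⟨d, fun x hx => hd fun i => ⟨x i, hx i⟩⟩

/-! ### Almost unary operations -/

theorem mem_almostUnary_iff (hb : ∀ S : Set X, IsSmall S ↔ BddAbove S) {n : ℕ+}
    {f : (Fin n → X) → X} :
    (⟨n, f⟩ : Op X) ∈ almostUnary X ↔ ∃ (γ : X → X) (k : Fin n), ∀ x, f x ≤ γ (x k) := by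
  constructor
  · rintro ⟨F, k, hF, h⟩
    choose γ hγ using fun y => (hb _).1 (hF y)
    exact ⟨γ, k, fun x => hγ _ (h x)⟩
  · rintro ⟨γ, k, h⟩
    exact ⟨fun y => Set.Iic (γ y), k, fun y => (hb _).2 bddAbove_Iic, h⟩

theorem isClone_almostUnary (hb : ∀ S : Set X, IsSmall S ↔ BddAbove S) :
    IsClone (almostUnary X) where
  proj_mem n k := (mem_almostUnary_iff hb).2 ⟨id, k, fun _ => le_rfl⟩
  comp_mem n m f g hf hg := by
    obtain ⟨γ, k, hγ⟩ := (mem_almostUnary_iff hb).1 hf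
    obtain ⟨δ, l, hδ⟩ := (mem_almostUnary_iff hb).1 (hg k)
    obtain ⟨ε, hε⟩ := exists_bound_on_Iic hb γ
    exact (mem_almostUnary_iff hb).2 ⟨ε ∘ δ, l, fun x => (hγ _).trans (hε _ _ (hδ x))⟩

/-! ### The almost unary operations are generated by the binary ones -/

section Generation

variable {D : Set (Op X)} {m : ℕ+}

theorem IsClone.comp_binary_mem (hD : IsClone D) (hT : T₁ X ⊆ D)
    (hb : ∀ S : Set X, IsSmall S ↔ BddAbove S) (p : X → X → X) (γ : X → X)
    (hp : ∀ a b, p a b ≤ γ a) {u v : (Fin m → X) → X} (hu : (⟨m, u⟩ : Op X) ∈ D)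
    (hv : (⟨m, v⟩ : Op X) ∈ D) : (⟨m, fun x => p (u x) (v x)⟩ : Op X) ∈ D := by
  have hmem : (⟨2, fun x => p (x ⟨0, PNat.pos 2⟩) (x ⟨1, by norm_num⟩)⟩ : Op X) ∈ D :=
    hT ⟨rfl, (mem_almostUnary_iff hb).2 ⟨γ, ⟨0, PNat.pos 2⟩, fun x => hp _ _⟩⟩
  have := hD.comp_mem 2 m _ (fun i => if i = ⟨0, PNat.pos 2⟩ then u else v) hmem
    (fun i => by split_ifs <;> assumption)
  simpa using this

theorem IsClone.mem_of_factorsThrough (hD : IsClone D) (hT : T₁ X ⊆ D)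
    (hb : ∀ S : Set X, IsSmall S ↔ BddAbove S) {f z : (Fin m → X) → X}
    (hz : (⟨m, z⟩ : Op X) ∈ D) (hf : f.FactorsThrough z) : (⟨m, f⟩ : Op X) ∈ D := by
  have := hD.comp_binary_mem hT hb (fun a _ => Function.extend z f id a)
    (Function.extend z f id) (fun _ _ => le_rfl) hz hz
  simpa only [hf.extend_apply] using this

/-- Operations bounded by a function of one and the same operation `y₀` can be coded, together
with `y₀`, into a single operation of the clone. The pairing function is only applied below a
bound that is computed from its first argument, and is thereby almost unary. -/
theorem IsClone.exists_code [Infinite X] (hD : IsClone D) (hT : T₁ X ⊆ D)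
    (hb : ∀ S : Set X, IsSmall S ↔ BddAbove S) {ι : Type*} (s : Finset ι)
    {y₀ : (Fin m → X) → X} {y : ι → (Fin m → X) → X} (γ : X → X)
    (h₀ : (⟨m, y₀⟩ : Op X) ∈ D) (hy : ∀ i, (⟨m, y i⟩ : Op X) ∈ D)
    (hγ : ∀ i x, y i x ≤ γ (y₀ x)) :
    ∃ z : (Fin m → X) → X, (⟨m, z⟩ : Op X) ∈ D ∧ y₀.FactorsThrough z ∧
      ∀ i ∈ s, (y i).FactorsThrough z := by
  classical
  induction s using Finset.induction_on with
  | empty => exact ⟨y₀, h₀, fun _ _ h => h, by simp⟩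
  | insert j s _ ih =>
    obtain ⟨z, hz, hz₀, hzs⟩ := ih
    obtain ⟨e⟩ : Nonempty (X × X ≃ X) := Cardinal.eq.1 (by simp)
    -- `dec` recovers `y₀` from `z`
    set dec := Function.extend z y₀ id with hdec
    have hdecz (x) : dec (z x) = y₀ x := hz₀.extend_apply id x
    let p (a b : X) : X := if b ≤ γ (dec a) then e (a, b) else a
    have hp (a : X) : ∃ c, ∀ b, p a b ≤ c := by
      obtain ⟨c, hc⟩ := exists_bound_on_Iic hb fun b => e (a, b)
      refine ⟨max (c (γ (dec a))) a, fun b => ?_⟩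
      dsimp only [p]
      split_ifs with h
      · exact le_max_of_le_left (hc _ _ h)
      · exact le_max_right _ _
    choose δ hδ using hp
    have hpz (x) : p (z x) (y j x) = e (z x, y j x) := if_pos (by rw [hdecz]; exact hγ j x)
    have key (x x') (h : p (z x) (y j x) = p (z x') (y j x')) : z x = z x' ∧ y j x = y j x' := by
      rw [hpz, hpz, e.apply_eq_iff_eq, Prod.mk.injEq] at h
      exact h
    refine ⟨_, hD.comp_binary_mem hT hb p δ hδ hz (hy j), fun x x' h => hz₀ (key x x' h).1,
      fun i hi x x' h => ?_⟩
    rcases Finset.mem_insert.1 hi with rfl | hi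
    · exact (key x x' h).2
    · exact hzs i hi (key x x' h).1

/-- Every clone containing the binary almost unary operations contains all almost unary
operations. If `x i` is the largest entry of `x`, all of `x` is coded below `x i`, hence the
restriction of `f` to the tuples whose largest entry is `x i` is available. These finitely many
restrictions are bounded in terms of `x k`, so they can be coded together with `x k`, and `f` is
their maximum. -/
theorem IsClone.almostUnary_subset [WellFoundedLT X] [Infinite X] (hD : IsClone D)
    (hT : T₁ X ⊆ D) (hb : ∀ S : Set X, IsSmall S ↔ BddAbove S) : almostUnary X ⊆ D := by
  classical
  rintro ⟨m, f⟩ hf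
  obtain ⟨γ, k, hγ⟩ := (mem_almostUnary_iff hb).1 hf
  obtain ⟨o, ho⟩ : ∃ o : X, ∀ a, o ≤ a :=
    ⟨wellFounded_lt.min Set.univ Set.univ_nonempty,
      fun a => not_lt.1 (wellFounded_lt.not_lt_min Set.univ (Set.mem_univ a))⟩
  choose σ hσ using exists_gt_of_isSmall_iff hb
  let r (i : Fin m) (x : Fin m → X) : X := if ∀ j, x j ≤ x i then f x else o
  have hr (i : Fin m) : (⟨m, r i⟩ : Op X) ∈ D := by
    have hmin (j : Fin m) : (⟨m, fun x => min (x j) (σ (x i))⟩ : Op X) ∈ D :=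
      hD.comp_binary_mem hT hb (fun a b => min b (σ a)) σ (fun _ _ => min_le_right _ _)
        (hD.proj_mem m i) (hD.proj_mem m j)
    obtain ⟨z, hz, hzi, hzj⟩ := hD.exists_code hT hb Finset.univ σ (hD.proj_mem m i) hmin
      (fun _ _ => min_le_right _ _)
    refine hD.mem_of_factorsThrough hT hb hz fun x x' h => ?_
    have hi : x i = x' i := hzi h
    have hj (j) : min (x j) (σ (x i)) = min (x' j) (σ (x' i)) := hzj j (Finset.mem_univ j) h
    -- truncation at `σ (x i) > x i` does not affect whether an entry is at most `x i`
    have hle (w : Fin m → X) (j) : w j ≤ w i ↔ min (w j) (σ (w i)) ≤ w i := by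
      rw [min_le_iff, or_iff_left (not_le.2 (hσ _))]
    have hiff : (∀ j, x j ≤ x i) ↔ ∀ j, x' j ≤ x' i :=
      forall_congr' fun j => by rw [hle x, hle x', hj j, hi]
    by_cases hx : ∀ j, x j ≤ x i
    · have hxx : x = x' := by
        funext j
        have := hj j
        rwa [min_eq_left ((hx j).trans (hσ _).le),
          min_eq_left ((hiff.1 hx j).trans (hσ _).le)] at this
      rw [hxx]
    · simp only [r, if_neg hx, if_neg (mt hiff.2 hx)]
  have hrle (i x) : r i x ≤ f x := by
    dsimp only [r]
    split_ifs
    exacts [le_rfl, ho _]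
  have hrmax (x) : ∃ i, r i x = f x := by
    have : Nonempty (Fin m) := ⟨k⟩
    obtain ⟨i, hi⟩ := Finite.exists_max x
    exact ⟨i, if_pos hi⟩
  obtain ⟨z, hz, -, hzr⟩ := hD.exists_code hT hb Finset.univ γ (hD.proj_mem m k) hr
    (fun i x => (hrle i x).trans (hγ x))
  refine hD.mem_of_factorsThrough hT hb hz fun x x' h => ?_
  have hrr (i) : r i x = r i x' := hzr i (Finset.mem_univ i) h
  obtain ⟨i, hi⟩ := hrmax x
  obtain ⟨i', hi'⟩ := hrmax x'
  exact le_antisymm (hi ▸ hrr i ▸ hrle i x') (hi' ▸ hrr i' ▸ hrle i' x)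

/-- Above the almost unary operations, clones are closed under domination: an operation `f`
bounded in terms of `g` arises by inserting `g` into an operation of one more variable that is
almost unary through this new variable. -/
theorem IsClone.mem_of_le (hD : IsClone D) (hU : almostUnary X ⊆ D)
    (hb : ∀ S : Set X, IsSmall S ↔ BddAbove S) {f g : (Fin m → X) → X} (γ : X → X)
    (hg : (⟨m, g⟩ : Op X) ∈ D) (hfg : ∀ x, f x ≤ γ (g x)) : (⟨m, f⟩ : Op X) ∈ D := by
  let m' : ℕ+ := ⟨m + 1, Nat.succ_pos _⟩
  let p : (Fin m' → X) → X := fun w => min (f (Fin.tail w)) (γ (w (0 : Fin (m + 1))))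
  have hp : (⟨m', p⟩ : Op X) ∈ D :=
    hU ((mem_almostUnary_iff hb).2 ⟨γ, (0 : Fin (m + 1)), fun _ => min_le_right _ _⟩)
  have := hD.comp_mem m' m p
    (Fin.cons (α := fun _ : Fin (m + 1) => (Fin m → X) → X) g fun i x => x i) hp
    (Fin.cases hg fun i => hD.proj_mem m i)
  convert this using 3 with x
  exact (min_eq_left (hfg x)).symm

end Generation

/-! ### The second smallest entry -/

section SecondSmallest

variable {n : ℕ+} (hn : 2 ≤ n) (y : Fin n → X)

theorem le_secondSmallest {v : X} (i₀ : Fin n) (h : ∀ i, i ≠ i₀ → v ≤ y i) :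
    v ≤ (secondSmallest X n hn).2 y := by
  change v ≤ y (Tuple.sort y ⟨1, hn⟩)
  by_cases h1 : Tuple.sort y ⟨1, hn⟩ = i₀
  · refine (h (Tuple.sort y ⟨0, n.pos⟩) fun h0 => ?_).trans
      (Tuple.monotone_sort y (Fin.mk_le_mk.2 zero_le_one))
    have := congrArg Fin.val ((Tuple.sort y).injective (h0.trans h1.symm))
    exact absurd this zero_ne_one
  · exact h _ h1

theorem secondSmallest_le {i : Fin n} (hi : i ≠ Tuple.sort y ⟨0, n.pos⟩) :
    (secondSmallest X n hn).2 y ≤ y i := by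
  obtain ⟨k, rfl⟩ := (Tuple.sort y).surjective i
  refine Tuple.monotone_sort y (Fin.mk_le_of_le_val (Nat.one_le_iff_ne_zero.2 fun h => hi ?_))
  rw [show k = ⟨0, n.pos⟩ from Fin.ext h]

end SecondSmallest

/-! ### Sets of variables that do not bound an operation -/

/-- The set `B` of variables does not bound `f`: for some `c`, the values of `f` at the tuples
whose entries in `B` are at most `c` are unbounded. -/
def UnboundedOver {n : ℕ} (f : (Fin n → X) → X) (B : Set (Fin n)) : Prop :=
  ∃ c, ∀ d, ∃ x, (∀ i ∈ B, x i ≤ c) ∧ d ≤ f x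

theorem not_unboundedOver_univ [Infinite X] (hb : ∀ S : Set X, IsSmall S ↔ BddAbove S) {n : ℕ}
    (f : (Fin n → X) → X) : ¬ UnboundedOver f Set.univ := by
  rintro ⟨c, hc⟩
  obtain ⟨d, hd⟩ := exists_bound_on_tuples hb f c
  obtain ⟨d', hd'⟩ := exists_gt_of_isSmall_iff hb d
  obtain ⟨x, hx, hdx⟩ := hc d'
  exact absurd (hd x fun i => hx i trivial) (not_le.2 (hd'.trans_le hdx))

/-- An operation that is not almost unary is not bounded by any single variable. -/
theorem unboundedOver_singleton (hb : ∀ S : Set X, IsSmall S ↔ BddAbove S) {n : ℕ+}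
    {f : (Fin n → X) → X} (hf : (⟨n, f⟩ : Op X) ∉ almostUnary X) (k : Fin n) :
    UnboundedOver f {k} := by
  by_contra h
  simp only [UnboundedOver, Set.mem_singleton_iff, forall_eq] at h
  push Not at h
  choose γ hγ using h
  exact hf ((mem_almostUnary_iff hb).2 ⟨γ, k, fun x => (hγ _ x le_rfl).le⟩)

/-- If the variables of `f` are covered by `n` sets `B j`, none of which bounds `f`, then `f` and
the almost unary operations generate `m^n_2`. Given `y` with smallest entry `y j` and second
smallest entry `d`, feed `f` with a tuple at which its value is at least `d` and whose entries
in `B j` are at most `c j`. The `i`-th entry of this tuple is an almost unary operation of `y`,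
through a variable `y b` with `i ∈ B b`: it is at most `c j` if `b = j`, and `d ≤ y b`
otherwise. -/
theorem IsClone.secondSmallest_mem [Nonempty X] {C : Set (Op X)} (hC : IsClone C)
    (hU : almostUnary X ⊆ C) (hb : ∀ S : Set X, IsSmall S ↔ BddAbove S) {N n : ℕ+} (hn : 2 ≤ n)
    {f : (Fin N → X) → X} (hf : (⟨N, f⟩ : Op X) ∈ C) {B : Fin n → Set (Fin N)}
    (hB : ∀ j, UnboundedOver f (B j)) (hcov : ∀ i, ∃ j, i ∈ B j) :
    secondSmallest X n hn ∈ C := by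
  choose c z hzc hzf using hB
  choose b hib using hcov
  let j (y : Fin n → X) : Fin n := Tuple.sort y ⟨0, n.pos⟩
  let d (y : Fin n → X) : X := (secondSmallest X n hn).2 y
  have hmem (i : Fin N) : (⟨n, fun y => z (j y) (d y) i⟩ : Op X) ∈ C := by
    obtain ⟨γ, hγ⟩ := exists_common_bound_on_Iic hb fun l a => z l a i
    refine hU ((mem_almostUnary_iff hb).2 ⟨fun a => max (c (b i)) (γ a), b i, fun y => ?_⟩)
    by_cases h : b i = j y
    · exact le_max_of_le_left (h ▸ hzc (b i) (d y) i (hib i))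
    · exact le_max_of_le_right (hγ _ _ _ (secondSmallest_le hn y h))
  exact hC.mem_of_le hU hb id (hC.comp_mem N n f _ hf hmem) fun y => hzf (j y) (d y)

/-- Let `S` be a finite family of sets of variables such that any fewer than `n` of its members
have a common element. Then a clone containing `m^n_2` contains an operation dominating
`x ↦ min_{i ∈ D} x i` for all `D ∈ S`. If `S` has at least `n` members, leave out `n` different
members in turn and apply `m^n_2` to the `n` resulting operations: at most one of them fails to
dominate the minimum over a given `D`. -/
theorem IsClone.exists_dominating {C : Set (Op X)} (hC : IsClone C) {N n : ℕ+} (hn : 2 ≤ n)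
    (hm : secondSmallest X n hn ∈ C) (S : Finset (Finset (Fin N)))
    (hS : ∀ S' ⊆ S, S'.card < n → ∃ i, ∀ D ∈ S', i ∈ D) :
    ∃ g, (⟨N, g⟩ : Op X) ∈ C ∧ ∀ D ∈ S, ∀ x v, (∀ i ∈ D, v ≤ x i) → v ≤ g x := by
  induction S using Finset.strongInduction with
  | H S ih =>
    rcases lt_or_ge S.card n with hcard | hcard
    · obtain ⟨k, hk⟩ := hS S subset_rfl hcard
      exact ⟨fun x => x k, hC.proj_mem N k, fun D hD x v h => h k (hk D hD)⟩
    · obtain ⟨e⟩ : Nonempty (Fin n ↪ S) :=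
        Function.Embedding.nonempty_of_card_le (by simpa using hcard)
      choose g hg hgS using fun j : Fin n => ih (S.erase (e j))
        (Finset.erase_ssubset (e j).2)
        fun S' hS' => hS S' (hS'.trans (Finset.erase_subset _ _))
      refine ⟨_, hC.comp_mem n N _ g hm hg, fun D hD x v h => ?_⟩
      have hne (j : Fin n) (hj : D ≠ e j) : v ≤ g j x :=
        hgS j D (Finset.mem_erase.2 ⟨hj, hD⟩) x v h
      by_cases hDe : ∃ j₀, D = e j₀
      · obtain ⟨j₀, rfl⟩ := hDe
        exact le_secondSmallest hn _ j₀ fun j hj =>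
          hne j fun h => hj (e.injective (Subtype.ext h)).symm
      · exact le_secondSmallest hn _ ⟨0, n.pos⟩ fun j _ => hne j fun h => hDe ⟨j, h⟩

/-- If the variables of `f` cannot be covered by fewer than `n` sets none of which bounds `f`,
then `f` is generated by `m^n_2` and the almost unary operations. Take `g` dominating the minimum
over the complement of each set not bounding `f`. The variables that are at most `g x` then bound
`f`, so `f x` is bounded in terms of `g x`. -/
theorem IsClone.mem_of_not_cover [Nonempty X] {C : Set (Op X)} (hC : IsClone C)
    (hU : almostUnary X ⊆ C) (hb : ∀ S : Set X, IsSmall S ↔ BddAbove S) {N n : ℕ+} (hn : 2 ≤ n)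
    (hm : secondSmallest X n hn ∈ C) {f : (Fin N → X) → X}
    (hf : ∀ k < (n : ℕ), ∀ B : Fin k → Set (Fin N), (∀ j, UnboundedOver f (B j)) →
      ∃ i, ∀ j, i ∉ B j) :
    (⟨N, f⟩ : Op X) ∈ C := by
  classical
  obtain ⟨g, hg, hgS⟩ := hC.exists_dominating hn hm
    (Finset.univ.filter fun D : Finset (Fin N) => UnboundedOver f (D : Set (Fin N))ᶜ) (by
      intro S' hS' hcard
      obtain ⟨i, hi⟩ := hf S'.card hcard (fun j => ((S'.equivFin.symm j : Finset (Fin N)) : Set _)ᶜ)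
        fun j => (Finset.mem_filter.1 (hS' (S'.equivFin.symm j).2)).2
      exact ⟨i, fun D hD => by simpa using hi (S'.equivFin ⟨D, hD⟩)⟩)
  have hbound (A : Finset (Fin N)) (v : X) : ∃ d, ¬ UnboundedOver f (A : Set (Fin N)) →
      ∀ x, (∀ i ∈ A, x i ≤ v) → f x ≤ d := by
    by_cases hA : UnboundedOver f (A : Set (Fin N))
    · exact ⟨v, fun h => absurd hA h⟩
    · have h := hA
      simp only [UnboundedOver] at h
      push Not at h
      obtain ⟨d, hd⟩ := h v
      exact ⟨d, fun _ x hx => (hd x hx).le⟩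
  choose δ hδ using hbound
  obtain ⟨γ, hγ⟩ := exists_common_bound_on_Iic hb δ
  refine hC.mem_of_le hU hb γ hg fun x => ?_
  let A : Finset (Fin N) := Finset.univ.filter fun i => x i ≤ g x
  have hA : ¬ UnboundedOver f (A : Set (Fin N)) := by
    intro hA
    -- otherwise `g` dominates the minimum over the complement of `A`, which exceeds `g x`
    have hgA := hgS Aᶜ (by simpa using hA) x
    by_cases hne : (Aᶜ).Nonempty
    · obtain ⟨i, hi, hmin⟩ := Aᶜ.exists_min_image x hne
      have : x i ≤ g x := hgA _ hmin
      exact absurd this (by simpa [A] using hi)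
    · obtain ⟨i, hi⟩ := hf 1 (lt_of_lt_of_le one_lt_two hn) (fun _ => A) fun _ => hA
      exact hne ⟨i, by simpa using hi 0⟩
  exact (hδ A (g x) hA x fun i hi => (Finset.mem_filter.1 hi).2).trans (hγ A _ _ le_rfl)

/-! ### The clones above the almost unary operations -/

theorem isClone_M (n : ℕ+) (hn : 2 ≤ n) : IsClone (M X n hn) := isClone_cloneGen _

theorem almostUnary_subset_M [WellFoundedLT X] [Infinite X]
    (hb : ∀ S : Set X, IsSmall S ↔ BddAbove S) (n : ℕ+) (hn : 2 ≤ n) :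
    almostUnary X ⊆ M X n hn :=
  (isClone_M n hn).almostUnary_subset (Set.subset_union_right.trans (subset_cloneGen _)) hb

/-- The index `n` is the smallest number of sets of variables, none of them bounding `f`, that
cover the variables of some member `f` of the clone. -/
theorem IsClone.exists_eq_M [WellFoundedLT X] [Infinite X] {C : Set (Op X)} (hC : IsClone C)
    (hb : ∀ S : Set X, IsSmall S ↔ BddAbove S) (hU : almostUnary X ⊂ C) :
    ∃ (n : ℕ+) (hn : 2 ≤ n), C = M X n hn := by
  classical
  let P (k : ℕ) : Prop := ∃ (N : ℕ+) (f : (Fin N → X) → X) (B : Fin k → Set (Fin N)),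
    (⟨N, f⟩ : Op X) ∈ C ∧ (∀ j, UnboundedOver f (B j)) ∧ ∀ i, ∃ j, i ∈ B j
  have hP : ∃ k, P k := by
    obtain ⟨⟨N, f⟩, hf, hfU⟩ := Set.exists_of_ssubset hU
    exact ⟨N, N, f, fun k => {k}, hf, unboundedOver_singleton hb hfU, fun i => ⟨i, rfl⟩⟩
  obtain ⟨N, f, B, hf, hB, hcov⟩ := Nat.find_spec hP
  have hmin : ∀ k < Nat.find hP, ¬ P k := fun k => Nat.find_min hP
  generalize Nat.find hP = n at B hB hcov hmin
  have hn : 2 ≤ n := by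
    by_contra! h
    obtain ⟨j₀, -⟩ := hcov ⟨0, N.pos⟩
    -- a single set covering all variables would be the set of all variables
    refine not_unboundedOver_univ hb f ?_
    convert hB j₀
    refine (Set.eq_univ_of_forall fun i => ?_).symm
    obtain ⟨j, hj⟩ := hcov i
    rwa [show j₀ = j from Fin.ext (by omega)]
  lift n to ℕ+ using by omega
  have hn' : (2 : ℕ+) ≤ n := hn
  refine ⟨n, hn', Set.Subset.antisymm ?_ ?_⟩
  · rintro ⟨N', f'⟩ hf'
    refine (isClone_M n hn').mem_of_not_cover (almostUnary_subset_M hb n hn') hb hn'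
      (subset_cloneGen _ (Or.inl rfl)) fun k hk B' hB' => ?_
    by_contra! hcov'
    exact hmin k hk ⟨N', f', B', hf', hB', hcov'⟩
  · refine cloneGen_subset hC (Set.union_subset ?_ fun g hg => hU.subset hg.2)
    exact Set.singleton_subset_iff.2 (hC.secondSmallest_mem hU.subset hb hn' hf hB hcov)

end Bounded

end CloneTheory

theorem mainTheorem1 (X : Type*) [LinearOrder X] [WellFoundedLT X]
    (hreg : (Cardinal.mk X).IsRegular)
    (htype : Ordinal.type ((· < ·) : X → X → Prop) = (Cardinal.mk X).ord) :
    CloneTheory.IsClone (CloneTheory.almostUnary X) ∧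
    (∀ C : Set (CloneTheory.Op X), CloneTheory.IsClone C → CloneTheory.almostUnary X ⊂ C →
      ∃ (n : ℕ+) (hn : 2 ≤ n), C = CloneTheory.M X n hn) ∧
    CloneTheory.cloneInterval (CloneTheory.almostUnary X) Set.univ =
      {C | ∃ (n : ℕ+) (hn : 2 ≤ n), C = CloneTheory.M X n hn} ∪ {CloneTheory.almostUnary X} := by
  have : Infinite X := Cardinal.infinite_iff.2 hreg.aleph0_le
  have hb := CloneTheory.isSmall_iff_bddAbove hreg htype
  have hU := CloneTheory.isClone_almostUnary hb
  have hM (C : Set (CloneTheory.Op X)) (hC : CloneTheory.IsClone C)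
      (hUC : CloneTheory.almostUnary X ⊂ C) : ∃ (n : ℕ+) (hn : 2 ≤ n), C = CloneTheory.M X n hn :=
    hC.exists_eq_M hb hUC
  refine ⟨hU, hM, Set.Subset.antisymm ?_ ?_⟩
  · rintro C ⟨hC, hUC, -⟩
    rcases hUC.eq_or_ssubset with rfl | hss
    · exact Or.inr rfl
    · exact Or.inl (hM C hC hss)
  · rintro C (⟨n, hn, rfl⟩ | rfl)
    · exact ⟨CloneTheory.isClone_M n hn, CloneTheory.almostUnary_subset_M hb n hn,
        Set.subset_univ _⟩
    · exact ⟨hU, subset_rfl, Set.subset_univ _⟩
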